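/- Let $K$ be a field, $S=K[x_1,\dots,x_n]$ and $m=(x_1,\dots,x_n)$. Let $I=Q_1\cap Q_2\cap Q_3$ be an irredundant primary decomposition (no $Q_i$ can be omitted), where each $Q_i$ is a monomial primary ideal of $S$, and put $P_i=\sqrt{Q_i}$. Assume $P_i\neq m$ for $i=1,2,3$. Here $\dim$ is Krull dimension and $\operatorname{depth}_S S/I$ is the maximal length of an $S/I$-regular sequence in $m$. Let $\operatorname{size} I=v+(n-h)-1$, where $h=\operatorname{height}(Q_1+Q_2+Q_3)$ and $v$ is the least $t\geq 1$ such that some $t$ of the ideals $Q_1,Q_2,Q_3$ have a sum with the same radical as $Q_1+Q_2+Q_3$. Then: (a) If $P_1+P_2+P_3=m$, $Q_1\subseteq Q_2+Q_3$, $P_1\not\subseteq P_2$ and $P_1\not\subseteq P_3$, then $\operatorname{depth}_S S/I=1+\min\{\dim S/(P_1+P_2),\ \dim S/(P_1+P_3)\}$. (b) If $Q_1\subseteq Q_2+Q_3$, $P_1\subseteq P_2$ and $P_1\not\subseteq P_3$, then $\operatorname{depth}_S S/I=\min\{\dim S/P_2,\ 1+\dim S/(P_1+P_3)\}$. (c)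 If $Q_1\subseteq Q_2+Q_3$, $P_1\subseteq P_2$ and $P_1\subseteq P_3$, then $\operatorname{depth}_S S/I=\min\{\dim S/P_2,\ \dim S/P_3\}$. (d) If $Q_i\not\subseteq\sum_{j\neq i}Q_j$ for every $i\in\{1,2,3\}$, then $\operatorname{depth}_S S/I=1$ if and only if $\operatorname{size} I=1$. (e) If $Q_i\not\subseteq\sum_{j\neq i}Q_j$ for every $i\in\{1,2,3\}$, then $\operatorname{depth}_S S/I=2$ if and only if $\operatorname{size} I=2$. -/

import Mathlib

open MvPolynomial

noncomputable section

/-- A monomial ideal of `K[x_1, …, x_n]`: an ideal generated by a set of monomials. -/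
def IsMonomialIdeal {K : Type*} [Field K] {n : ℕ} (I : Ideal (MvPolynomial (Fin n) K)) : Prop :=
  ∃ A : Set (Fin n →₀ ℕ), I = Ideal.span ((fun a => monomial a (1 : K)) '' A)

/-- `I = Q_1 ∩ ⋯ ∩ Q_s` is an irredundant primary decomposition of `I` by monomial primary ideals:
no `Q_i` may be omitted from the intersection. -/
structure IsIrredundantMonomialPrimaryDecomposition {K : Type*} [Field K] {n s : ℕ}
    (I : Ideal (MvPolynomial (Fin n) K)) (Q : Fin s → Ideal (MvPolynomial (Fin n) K)) : Prop where
  eq_iInf : I = ⨅ i, Q i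
  monomial : ∀ i, IsMonomialIdeal (Q i)
  primary : ∀ i, (Q i).IsPrimary
  irredundant : ∀ i, ¬ (⨅ j ≠ i, Q j) ≤ Q i

/-- The least number `t ≥ 1` of members of the family `Q` whose sum has the same radical as the
sum of the whole family. -/
def radicalCoverNumber {R : Type*} [CommRing R] {s : ℕ} (Q : Fin s → Ideal R) : ℕ :=
  sInf {t : ℕ | ∃ J : Finset (Fin s), J.Nonempty ∧ J.card = t ∧
    (⨆ j ∈ J, Q j).radical = (⨆ j, Q j).radical}

/-- Lyubeznik's size `v + (n - h) - 1` of the ideal `⋂ Q_i` of `K[x_1, …, x_n]`, computed from an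
irredundant primary decomposition `Q`; `h` is the height of `∑ Q_i`. -/
def decompositionSize {K : Type*} [Field K] {n s : ℕ}
    (Q : Fin s → Ideal (MvPolynomial (Fin n) K)) : ℤ :=
  (radicalCoverNumber Q : ℤ) + ((n : ℤ) - ((⨆ j, Q j).height.toNat : ℤ)) - 1

/-- The supremum of the lengths of the `M`-regular sequences with all entries in the ideal `J`. -/
def depthIn {R : Type*} [CommRing R] (J : Ideal R) (M : Type*) [AddCommGroup M] [Module R M] :
    ℕ∞ :=
  ⨆ rs ∈ {rs : List R | (∀ r ∈ rs, r ∈ J) ∧ RingTheory.Sequence.IsRegular M rs},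
    (rs.length : ℕ∞)

/-- `depth_S S/I` for `S = K[x_1, …, x_n]`: the depth with respect to the graded maximal ideal
`m = (x_1, …, x_n)`. -/
def depthQuot {K : Type*} [Field K] {n : ℕ} (I : Ideal (MvPolynomial (Fin n) K)) : ℕ∞ :=
  depthIn (idealOfVars (Fin n) K) (MvPolynomial (Fin n) K ⧸ I)

end

/-!
The theorem is a computation of depth through exact sequences. Depth is handled through Rees'
theorem: `S/I` contains a regular sequence of length `r` in `m` if and only if
`Ext^i(S/m, S/I) = 0` for all `i < r`. This makes lower and upper bounds for the depth propagate
along short exact sequences, chiefly the sequences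
`0 → S/(I ∩ J) → S/I × S/J → S/(I + J) → 0`. They are useful here because monomial ideals form
a distributive lattice, so that the sums that occur are again intersections of sums of the `Qᵢ`.

Two inputs start the computation. A monomial primary ideal is described by the set `A` of the
variables in its radical (`IsMonomialPrimaryTo`); such ideals are closed under sums, with the sets
`A` added up, and their quotients have depth `n - |A|` because the variables outside `A` form a
regular sequence. Secondly, the depth is at most `dim S/P` for each associated prime `P ⊆ m`
(`DepthAtLeast.le_ringKrullDim`), and a monomial primary component that is not superfluous
contributes its radical as an associated prime (`IsMonomialPrimaryTo.isAssociatedPrime`).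

If `Q₁ ⊆ Q₂ + Q₃`, then `(Q₁ ∩ Q₂) + (Q₁ ∩ Q₃) = Q₁`, so `S/I` is the fibre product of
`S/(Q₁ ∩ Q₂)` and `S/(Q₁ ∩ Q₃)` over `S/Q₁` and its depth is the minimum `b` of their depths: for
`b < dim S/Q₁` this comes from the long exact sequence, and for `b = dim S/Q₁` the associated prime
`P₁` gives the upper bound (`depthQuot_eq_of_le_sup`). If no `Qᵢ` is contained in the sum of the
other two, the depth is always equal to the size (`depthQuot_eq_decompositionSize`), by
distinguishing whether one, two or three of the `Pᵢ` are needed to obtain `P₁ + P₂ + P₃`.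
-/

universe u

/-! ### Depth and short exact sequences -/

section Depth

open CategoryTheory Abelian RingTheory.Sequence
open scoped Pointwise

variable {R : Type u} [CommRing R] (m : Ideal R)

/-- `Ext^i(R/m, M) = 0` for all `i < r`. By Rees' theorem this says that the depth of `M` with
respect to `m` is at least `r`. -/
def DepthAtLeast (M : Type u) [AddCommGroup M] [Module R M] (r : ℕ) : Prop :=
  ∀ i < r, Subsingleton (Ext.{u} (ModuleCat.of R (R ⧸ m)) (ModuleCat.of R M) i)

variable {m} {A B C : Type u} [AddCommGroup A] [Module R A] [AddCommGroup B] [Module R B]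
  [AddCommGroup C] [Module R C]

theorem DepthAtLeast.mono {r s : ℕ} (h : DepthAtLeast m A s) (hrs : r ≤ s) :
    DepthAtLeast m A r :=
  fun i hi => h i (hi.trans_le hrs)

/-- Rees' theorem: `DepthAtLeast` is the existence of a regular sequence of length `r` in `m`. -/
theorem depthAtLeast_iff_exists_isRegular [IsNoetherianRing R] [Module.Finite R A]
    (hA : m • (⊤ : Submodule R A) < ⊤) (r : ℕ) :
    DepthAtLeast m A r ↔
      ∃ rs : List R, rs.length = r ∧ (∀ x ∈ rs, x ∈ m) ∧ IsRegular A rs := by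
  have hs : Module.support R (R ⧸ m) = PrimeSpectrum.zeroLocus m := by
    rw [Module.support_eq_zeroLocus, Ideal.annihilator_quotient]
  constructor
  · intro h
    exact ModuleCat.exists_isRegular_of_exists_subsingleton_ext m r (ModuleCat.of R A) hA
      (ModuleCat.of R (R ⧸ m)) hs h
  · rintro ⟨rs, rfl, hrs, hreg⟩
    exact ModuleCat.subsingleton_ext_of_exists_isRegular m (ModuleCat.of R (R ⧸ m)) hs.subset
      (ModuleCat.of R A) hA rs hrs hreg

section ShortExact

variable {f : A →ₗ[R] B} {g : B →ₗ[R] C}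

theorem shortExact_ofHom (hf : Function.Injective f) (hg : Function.Surjective g)
    (hfg : Function.Exact f g) :
    (ShortComplex.mk (ModuleCat.ofHom f) (ModuleCat.ofHom g)
      (by ext x; exact hfg.apply_apply_eq_zero x)).ShortExact where
  exact := (ShortComplex.ShortExact.moduleCat_exact_iff_function_exact _).2 hfg
  mono_f := (ModuleCat.mono_iff_injective _).2 hf
  epi_g := (ModuleCat.epi_iff_surjective _).2 hg

theorem DepthAtLeast.left (hf : Function.Injective f) (hg : Function.Surjective g)
    (hfg : Function.Exact f g) {r s : ℕ} (hB : DepthAtLeast m B r) (hC : DepthAtLeast m C s)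
    (hrs : r ≤ s + 1) : DepthAtLeast m A r := by
  intro i hi
  have hS := shortExact_ofHom hf hg hfg
  have := hB i hi
  refine subsingleton_of_forall_eq 0 fun x => ?_
  cases i with
  | zero =>
    exact Ext.postcomp_mk₀_injective_of_mono _ (ModuleCat.ofHom f) (hf := hS.mono_f)
      (Subsingleton.elim (h := this) _ _)
  | succ i =>
    obtain ⟨y, rfl⟩ := Ext.covariant_sequence_exact₁ _ hS x (Subsingleton.elim (h := this) _ _) rfl
    have := hC i (by omega)
    rw [Subsingleton.elim (h := this) y 0, Ext.zero_comp]

theorem DepthAtLeast.right (hf : Function.Injective f) (hg : Function.Surjective g)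
    (hfg : Function.Exact f g) {r : ℕ} (hA : DepthAtLeast m A (r + 1)) (hB : DepthAtLeast m B r) :
    DepthAtLeast m C r := by
  intro i hi
  have hS := shortExact_ofHom hf hg hfg
  refine subsingleton_of_forall_eq 0 fun x => ?_
  obtain ⟨y, rfl⟩ := Ext.covariant_sequence_exact₃ _ hS x rfl
    (Subsingleton.elim (h := hA (i + 1) (by omega)) _ _)
  rw [Subsingleton.elim (h := hB i hi) y 0, Ext.zero_comp]

theorem DepthAtLeast.middle (hf : Function.Injective f) (hg : Function.Surjective g)
    (hfg : Function.Exact f g) {r : ℕ} (hA : DepthAtLeast m A r) (hC : DepthAtLeast m C r) :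
    DepthAtLeast m B r := by
  intro i hi
  have hS := shortExact_ofHom hf hg hfg
  refine subsingleton_of_forall_eq 0 fun x => ?_
  obtain ⟨y, rfl⟩ := Ext.covariant_sequence_exact₂ _ hS x
    (Subsingleton.elim (h := hC i (by omega)) _ _)
  rw [Subsingleton.elim (h := hA i hi) y 0, Ext.zero_comp]

end ShortExact

theorem DepthAtLeast.of_leftInverse {i : A →ₗ[R] B} {p : B →ₗ[R] A} (h : p ∘ₗ i = LinearMap.id)
    {r : ℕ} (hB : DepthAtLeast m B r) : DepthAtLeast m A r := by
  intro k hk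
  refine subsingleton_of_forall_eq 0 fun x => ?_
  have hx : (x.comp (Ext.mk₀ (ModuleCat.ofHom i)) (add_zero k)).comp
      (Ext.mk₀ (ModuleCat.ofHom p)) (add_zero k) = x := by
    rw [Ext.comp_assoc_of_third_deg_zero, Ext.mk₀_comp_mk₀, ← ModuleCat.ofHom_comp, h]
    exact Ext.comp_mk₀_id x
  rw [← hx, Subsingleton.elim (h := hB k hk) (x.comp _ _) 0, Ext.zero_comp]

theorem depthAtLeast_prod_iff {r : ℕ} :
    DepthAtLeast m (A × B) r ↔ DepthAtLeast m A r ∧ DepthAtLeast m B r := by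
  refine ⟨fun h => ⟨h.of_leftInverse (LinearMap.fst_comp_inl R A B),
    h.of_leftInverse (LinearMap.snd_comp_inr R A B)⟩, fun h => ?_⟩
  exact DepthAtLeast.middle LinearMap.inl_injective LinearMap.snd_surjective .inl_snd h.1 h.2

/-! ### The exact sequence of a sum and an intersection of ideals -/

section SumIntersection

variable (m) (I J : Ideal R)

/-- The diagonal map `R/(I ∩ J) → R/I × R/J`. -/
def quotientInfToProd : (R ⧸ I ⊓ J) →ₗ[R] (R ⧸ I) × (R ⧸ J) :=
  (Submodule.factor inf_le_left).prod (Submodule.factor inf_le_right)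

/-- The difference map `R/I × R/J → R/(I + J)`. -/
def quotientProdToSup : (R ⧸ I) × (R ⧸ J) →ₗ[R] R ⧸ I ⊔ J :=
  (Submodule.factor le_sup_left).coprod (-Submodule.factor le_sup_right)

theorem quotientInfToProd_injective : Function.Injective (quotientInfToProd I J) := by
  rw [injective_iff_map_eq_zero]
  intro x hx
  obtain ⟨x, rfl⟩ := Submodule.Quotient.mk_surjective _ x
  have h := Prod.ext_iff.1 hx
  exact (Submodule.Quotient.mk_eq_zero _).2 ⟨(Submodule.Quotient.mk_eq_zero _).1 h.1,
    (Submodule.Quotient.mk_eq_zero _).1 h.2⟩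

theorem quotientProdToSup_surjective : Function.Surjective (quotientProdToSup I J) := by
  intro x
  obtain ⟨x, rfl⟩ := Submodule.Quotient.mk_surjective _ x
  exact ⟨(Submodule.Quotient.mk x, 0), by simp [quotientProdToSup]⟩

theorem exact_quotientInfToProd_quotientProdToSup :
    Function.Exact (quotientInfToProd I J) (quotientProdToSup I J) := by
  rintro ⟨x, y⟩
  obtain ⟨x, rfl⟩ := Submodule.Quotient.mk_surjective _ x
  obtain ⟨y, rfl⟩ := Submodule.Quotient.mk_surjective _ y
  have key : quotientProdToSup I J (Submodule.Quotient.mk x, Submodule.Quotient.mk y) =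
      Submodule.Quotient.mk (x - y) := by
    simp [quotientProdToSup, sub_eq_add_neg]
  rw [key, Submodule.Quotient.mk_eq_zero]
  constructor
  · intro h
    obtain ⟨a, ha, b, hb, hab⟩ := Submodule.mem_sup.1 h
    refine ⟨Submodule.Quotient.mk (x - a), Prod.ext ?_ ?_⟩
    · refine (Submodule.Quotient.eq _).2 ?_
      simpa using ha
    · refine (Submodule.Quotient.eq _).2 ?_
      change x - a - y ∈ J
      rwa [show x - a - y = b by linear_combination -hab]
  · rintro ⟨z, hz⟩
    obtain ⟨z, rfl⟩ := Submodule.Quotient.mk_surjective _ z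
    have h := Prod.ext_iff.1 hz
    have h1 : z - x ∈ I := (Submodule.Quotient.eq _).1 h.1
    have h2 : z - y ∈ J := (Submodule.Quotient.eq _).1 h.2
    have : x - y = -(z - x) + (z - y) := by ring
    rw [this]
    exact Submodule.add_mem_sup (neg_mem h1) h2

variable {m I J}

theorem DepthAtLeast.quotient_inf {r s : ℕ} (hI : DepthAtLeast m (R ⧸ I) r)
    (hJ : DepthAtLeast m (R ⧸ J) r) (h : DepthAtLeast m (R ⧸ I ⊔ J) s) (hrs : r ≤ s + 1) :
    DepthAtLeast m (R ⧸ I ⊓ J) r :=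
  .left (quotientInfToProd_injective I J) (quotientProdToSup_surjective I J)
    (exact_quotientInfToProd_quotientProdToSup I J) (depthAtLeast_prod_iff.2 ⟨hI, hJ⟩) h hrs

theorem DepthAtLeast.quotient_sup {r : ℕ} (hI : DepthAtLeast m (R ⧸ I) r)
    (hJ : DepthAtLeast m (R ⧸ J) r) (h : DepthAtLeast m (R ⧸ I ⊓ J) (r + 1)) :
    DepthAtLeast m (R ⧸ I ⊔ J) r :=
  .right (quotientInfToProd_injective I J) (quotientProdToSup_surjective I J)
    (exact_quotientInfToProd_quotientProdToSup I J) h (depthAtLeast_prod_iff.2 ⟨hI, hJ⟩)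

theorem DepthAtLeast.of_quotient_inf_of_quotient_sup {r : ℕ} (h : DepthAtLeast m (R ⧸ I ⊓ J) r)
    (h' : DepthAtLeast m (R ⧸ I ⊔ J) r) :
    DepthAtLeast m (R ⧸ I) r ∧ DepthAtLeast m (R ⧸ J) r :=
  depthAtLeast_prod_iff.1 <| .middle (quotientInfToProd_injective I J)
    (quotientProdToSup_surjective I J) (exact_quotientInfToProd_quotientProdToSup I J) h h'

end SumIntersection

/-! ### Associated primes bound the depth -/

section AssociatedPrime

variable [IsNoetherianRing R]

/-- If `x ∈ m` is `M`-regular and `P ⊆ m` is associated to `M`, then some prime `P' ⊆ m`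
containing `P + (x)` is associated to `M/xM`. -/
theorem exists_isAssociatedPrime_quotSMulTop [m.IsMaximal] [Module.Finite R A] {x : R}
    (hxm : x ∈ m) (hx : IsSMulRegular A x) {P : Ideal R} (hP : IsAssociatedPrime P A)
    (hPm : P ≤ m) :
    ∃ P' : Ideal R, IsAssociatedPrime P' (QuotSMulTop x A) ∧ P' ≤ m ∧ P ≤ P' ∧ x ∈ P' := by
  obtain ⟨hPp, z, hz⟩ := isAssociatedPrime_iff.1 hP
  have hPz : ∀ p : R, p ∈ P ↔ p • z = 0 := by
    intro p; rw [hz, Submodule.mem_colon_singleton, Submodule.mem_bot]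
  -- the submodule of elements of `A` killed by `P`
  let N : Submodule R A := Submodule.torsionBySet R A P
  have hN : ∀ y, y ∈ N ↔ ∀ p ∈ P, p • y = 0 := fun y => by
    simp [N, Submodule.mem_torsionBySet_iff]
  have hzN : z ∈ N := (hN z).2 fun p hp => (hPz p).1 hp
  obtain ⟨y, hyN, hy⟩ : ∃ y ∈ N, ∀ s : R, s • y ∈ x • (⊤ : Submodule R A) → s ∈ m := by
    by_contra! hcon
    -- otherwise `N = mN`, and by Nakayama's lemma an element outside `m` kills `z`
    have hle : N ≤ m • N := by
      intro y hy
      obtain ⟨s, hs, hsm⟩ := hcon y hy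
      obtain ⟨w, -, hw⟩ := (Submodule.mem_smul_pointwise_iff_exists _ _ _).1 hs
      have hwN : w ∈ N := (hN w).2 fun p hp => hx <| by
        change x • p • w = x • 0
        rw [smul_comm, hw, smul_comm, (hN y).1 hy p hp, smul_zero, smul_zero]
      obtain ⟨t, μ, hμ, htμ⟩ := Ideal.IsMaximal.exists_inv ‹m.IsMaximal› hsm
      have : y = x • t • w + μ • y := by
        rw [smul_comm, hw, smul_smul, ← add_smul, htμ, one_smul]
      rw [this]
      exact add_mem (Submodule.smul_mem_smul hxm (N.smul_mem _ hwN))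
        (Submodule.smul_mem_smul hμ hy)
    obtain ⟨r, hr, hrN⟩ := Submodule.exists_sub_one_mem_and_smul_eq_zero_of_fg_of_le_smul m N
      (IsNoetherian.noetherian N) hle
    have hrm : r ∈ m := hPm ((hPz r).2 (hrN z hzN))
    exact ‹m.IsMaximal›.ne_top ((Ideal.eq_top_iff_one _).2 (by simpa using sub_mem hrm hr))
  let ybar : QuotSMulTop x A := Submodule.Quotient.mk y
  have hann : ∀ s : R, s ∈ Module.annihilator R (Submodule.span R {ybar}) ↔
      s • y ∈ x • (⊤ : Submodule R A) := fun s => by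
    rw [← Submodule.annihilator, Submodule.mem_annihilator_span_singleton,
      ← Submodule.Quotient.mk_smul, Submodule.Quotient.mk_eq_zero]
  have hle : Module.annihilator R (Submodule.span R {ybar}) ≤ m := fun s hs => hy s ((hann s).1 hs)
  -- the required prime is minimal over the annihilator of the class of `y` in `A/xA`
  obtain ⟨P', hP', hP'm⟩ := Ideal.exists_minimalPrimes_le hle
  have hass := Module.associatedPrimes.minimalPrimes_annihilator_subset_associatedPrimes R _ hP'
  refine ⟨P', associatedPrimes.subset_of_injective
    (f := (Submodule.span R {ybar}).subtype) Subtype.val_injective hass, hP'm, ?_, ?_⟩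
  · intro p hp
    exact hP'.1.2 ((hann p).2 (by rw [(hN y).1 hyN p hp]; exact zero_mem _))
  · exact hP'.1.2 ((hann x).2 (Submodule.smul_mem_pointwise_smul _ _ _ trivial))

theorem ringKrullDim_quotient_add_one_le_of_lt {R : Type*} [CommRing R] {P P' : Ideal R}
    [P.IsPrime] (h : P < P') : ringKrullDim (R ⧸ P') + 1 ≤ ringKrullDim (R ⧸ P) := by
  obtain ⟨x, hx', hx⟩ := SetLike.exists_of_lt h
  refine ringKrullDim_succ_le_of_surjective (Ideal.Quotient.factor h.le)
    (Ideal.Quotient.factor_surjective h.le) (r := Ideal.Quotient.mk P x) ?_ ?_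
  · exact mem_nonZeroDivisors_of_ne_zero (by simpa [Ideal.Quotient.eq_zero_iff_mem] using hx)
  · simpa [Ideal.Quotient.eq_zero_iff_mem] using hx'

/-- Passing from `A` to `A/xA` lowers the dimension of some associated prime by at least one. -/
theorem length_le_ringKrullDim_of_isAssociatedPrime [m.IsMaximal] [Module.Finite R A]
    {rs : List R} (hrs : ∀ x ∈ rs, x ∈ m) (hreg : IsWeaklyRegular A rs)
    {P : Ideal R} (hP : IsAssociatedPrime P A) (hPm : P ≤ m) :
    (rs.length : WithBot ℕ∞) ≤ ringKrullDim (R ⧸ P) := by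
  induction rs generalizing A P with
  | nil =>
    have := hP.isPrime
    simpa using ringKrullDim_nonneg_of_nontrivial
  | cons x rs ih =>
    rw [isWeaklyRegular_cons_iff] at hreg
    obtain ⟨P', hP', hP'm, hle, hxP'⟩ := exists_isAssociatedPrime_quotSMulTop
      (hrs x List.mem_cons_self) hreg.1 hP hPm
    have hxP : x ∉ P := by
      intro hxP
      obtain ⟨hPp, z, hz⟩ := isAssociatedPrime_iff.1 hP
      rw [hz, Submodule.mem_colon_singleton, Submodule.mem_bot] at hxP
      have hz0 : z = 0 := hreg.1 (by simpa using hxP)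
      exact hPp.ne_top (by simp [hz, hz0])
    have := hP.isPrime
    have h1 := ih (fun y hy => hrs y (List.mem_cons_of_mem _ hy)) hreg.2 hP' hP'm
    have h2 := ringKrullDim_quotient_add_one_le_of_lt
      (lt_of_le_of_ne hle fun h => hxP (h ▸ hxP'))
    rw [List.length_cons, Nat.cast_succ]
    exact (by gcongr : _ ≤ _).trans h2

end AssociatedPrime

/-! ### Depth of quotient rings -/

section Quotient

variable {I : Ideal R}

theorem smul_top_quotient_lt_top (hm : m ≠ ⊤) (hI : I ≤ m) :
    m • (⊤ : Submodule R (R ⧸ I)) < ⊤ := by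
  refine lt_top_iff_ne_top.2 fun h => hm ?_
  have h1 := congrArg (Submodule.comap I.mkQ) h
  rw [Submodule.comap_smul_top_of_surjective m _ (Submodule.mkQ_surjective I)] at h1
  simpa [hI] using h1

theorem smul_top_quotient_eq_map (x : R) :
    x • (⊤ : Submodule R (R ⧸ I)) = Submodule.map I.mkQ (I ⊔ Ideal.span {x}) := by
  rw [Submodule.map_sup, Submodule.mkQ_map_self, bot_sup_eq, ← Submodule.ideal_span_singleton_smul,
    ← Submodule.range_mkQ, LinearMap.range_eq_map, ← Submodule.map_smul'', smul_eq_mul,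
    Ideal.mul_top]

variable (I) in
/-- The isomorphism `(R/I) / x(R/I) ≃ R/(I + (x))`. -/
def quotSMulTopQuotientEquiv (x : R) : QuotSMulTop x (R ⧸ I) ≃ₗ[R] R ⧸ I ⊔ Ideal.span {x} :=
  (Submodule.quotEquivOfEq _ _ (smul_top_quotient_eq_map (I := I) x)).trans
    (Submodule.quotientQuotientEquivQuotient I _ le_sup_left)

theorem isRegular_quotient_cons {x : R} {rs : List R} (hx : IsSMulRegular (R ⧸ I) x)
    (hreg : IsRegular (R ⧸ I ⊔ Ideal.span {x}) rs) : IsRegular (R ⧸ I) (x :: rs) :=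
  IsRegular.cons hx (((quotSMulTopQuotientEquiv I x).isRegular_congr rs).2 hreg)

theorem depthAtLeast_quotient_iff_exists_isRegular [IsNoetherianRing R] (hm : m ≠ ⊤) (hI : I ≤ m)
    (r : ℕ) : DepthAtLeast m (R ⧸ I) r ↔
      ∃ rs : List R, rs.length = r ∧ (∀ x ∈ rs, x ∈ m) ∧ IsRegular (R ⧸ I) rs := by
  have hlt := smul_top_quotient_lt_top hm hI
  have hiff := depthAtLeast_iff_exists_isRegular (m := m) (A := R ⧸ I) hlt r
  exact hiff

/-- A regular element of `m` lifts depth bounds from `R/(I + (x))` to `R/I`. -/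
theorem DepthAtLeast.of_isSMulRegular [IsNoetherianRing R] (hm : m ≠ ⊤) (hI : I ≤ m) {x : R}
    (hxm : x ∈ m) (hx : IsSMulRegular (R ⧸ I) x) {r : ℕ}
    (h : DepthAtLeast m (R ⧸ I ⊔ Ideal.span {x}) r) : DepthAtLeast m (R ⧸ I) (r + 1) := by
  have hIx : I ⊔ Ideal.span {x} ≤ m := sup_le hI ((Ideal.span_singleton_le_iff_mem _).2 hxm)
  obtain ⟨rs, hlen, hrs, hreg⟩ := (depthAtLeast_quotient_iff_exists_isRegular hm hIx r).1 h
  exact (depthAtLeast_quotient_iff_exists_isRegular hm hI _).2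
    ⟨x :: rs, by rw [List.length_cons, hlen], List.forall_mem_cons.2 ⟨hxm, hrs⟩,
      isRegular_quotient_cons hx hreg⟩

/-- The depth of `R/I` is at most the dimension of `R/P` for every prime `P` associated to
`R/I`. -/
theorem DepthAtLeast.le_ringKrullDim [IsNoetherianRing R] [m.IsMaximal] (hI : I ≤ m)
    {P : Ideal R} (hP : IsAssociatedPrime P (R ⧸ I)) (hPm : P ≤ m) {r : ℕ}
    (h : DepthAtLeast m (R ⧸ I) r) : (r : WithBot ℕ∞) ≤ ringKrullDim (R ⧸ P) := by
  obtain ⟨rs, rfl, hrs, hreg⟩ :=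
    (depthAtLeast_quotient_iff_exists_isRegular (Ideal.IsMaximal.ne_top ‹_›) hI r).1 h
  exact length_le_ringKrullDim_of_isAssociatedPrime (A := R ⧸ I) hrs hreg.toIsWeaklyRegular hP hPm

theorem depthIn_quotient_eq [IsNoetherianRing R] (hm : m ≠ ⊤) (hI : I ≤ m) {d : ℕ}
    (h : DepthAtLeast m (R ⧸ I) d) (h' : ¬ DepthAtLeast m (R ⧸ I) (d + 1)) :
    depthIn m (R ⧸ I) = d := by
  refine le_antisymm (iSup₂_le ?_) ?_
  · rintro rs ⟨hrs, hreg⟩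
    by_contra! hlt
    exact h' (((depthAtLeast_quotient_iff_exists_isRegular hm hI _).2 ⟨rs, rfl, hrs, hreg⟩).mono
      (by exact_mod_cast hlt))
  · obtain ⟨rs, rfl, hrs, hreg⟩ := (depthAtLeast_quotient_iff_exists_isRegular hm hI d).1 h
    exact le_iSup₂_of_le rs ⟨hrs, hreg⟩ le_rfl

end Quotient

end Depth

/-! ### Monomial ideals -/

noncomputable section MonomialIdeal

variable {K : Type*} [Field K] {n : ℕ} {I J L Q Q' : Ideal (MvPolynomial (Fin n) K)}
  {A A' : Finset (Fin n)}

theorem mem_support_monomial_one {a b : Fin n →₀ ℕ} :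
    b ∈ (monomial a (1 : K)).support ↔ b = a := by
  classical
  rw [support_monomial, if_neg one_ne_zero, Finset.mem_singleton]

namespace IsMonomialIdeal

theorem monomial_mem (hI : IsMonomialIdeal I) {p : MvPolynomial (Fin n) K} (hp : p ∈ I)
    {a : Fin n →₀ ℕ} (ha : a ∈ p.support) : monomial a (1 : K) ∈ I := by
  obtain ⟨S, rfl⟩ := hI
  obtain ⟨s, hs, hsa⟩ := mem_ideal_span_monomial_image.1 hp a ha
  refine mem_ideal_span_monomial_image.2 fun b hb => ⟨s, hs, ?_⟩
  exact (mem_support_monomial_one.1 hb) ▸ hsa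

theorem _root_.Ideal.mem_of_forall_monomial_mem {p : MvPolynomial (Fin n) K}
    (h : ∀ a ∈ p.support, monomial a (1 : K) ∈ I) : p ∈ I := by
  rw [p.as_sum]
  refine Ideal.sum_mem _ fun a ha => ?_
  have : monomial a (coeff a p) = C (coeff a p) * monomial a (1 : K) := by
    rw [C_mul_monomial, mul_one]
  rw [this]
  exact Ideal.mul_mem_left _ _ (h a ha)

theorem of_forall_monomial_mem
    (h : ∀ p ∈ I, ∀ a ∈ p.support, monomial a (1 : K) ∈ I) : IsMonomialIdeal I := by
  refine ⟨{a | monomial a (1 : K) ∈ I}, le_antisymm (fun p hp => ?_) ?_⟩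
  · exact Ideal.mem_of_forall_monomial_mem fun a ha => Ideal.subset_span ⟨a, h p hp a ha, rfl⟩
  · rw [Ideal.span_le]
    rintro _ ⟨a, ha, rfl⟩
    exact ha

theorem le_iff (hI : IsMonomialIdeal I) :
    I ≤ J ↔ ∀ a, monomial a (1 : K) ∈ I → monomial a (1 : K) ∈ J :=
  ⟨fun h _ ha => h ha, fun h _ hp =>
    Ideal.mem_of_forall_monomial_mem fun a ha => h a (hI.monomial_mem hp ha)⟩

theorem ext (hI : IsMonomialIdeal I) (hJ : IsMonomialIdeal J)
    (h : ∀ a, monomial a (1 : K) ∈ I ↔ monomial a (1 : K) ∈ J) : I = J :=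
  le_antisymm (hI.le_iff.2 fun a => (h a).1) (hJ.le_iff.2 fun a => (h a).2)

theorem top : IsMonomialIdeal (⊤ : Ideal (MvPolynomial (Fin n) K)) :=
  of_forall_monomial_mem fun _ _ _ _ => trivial

theorem inf (hI : IsMonomialIdeal I) (hJ : IsMonomialIdeal J) : IsMonomialIdeal (I ⊓ J) :=
  of_forall_monomial_mem fun _ hp _ ha => ⟨hI.monomial_mem hp.1 ha, hJ.monomial_mem hp.2 ha⟩

theorem sup (hI : IsMonomialIdeal I) (hJ : IsMonomialIdeal J) : IsMonomialIdeal (I ⊔ J) := by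
  obtain ⟨S, rfl⟩ := hI
  obtain ⟨T, rfl⟩ := hJ
  exact ⟨S ∪ T, by rw [Set.image_union, Ideal.span_union]⟩

theorem monomial_mem_sup_iff (hI : IsMonomialIdeal I) (hJ : IsMonomialIdeal J) {a : Fin n →₀ ℕ} :
    monomial a (1 : K) ∈ I ⊔ J ↔ monomial a (1 : K) ∈ I ∨ monomial a (1 : K) ∈ J := by
  refine ⟨fun h => ?_, fun h => h.elim (fun h => le_sup_left (a := I) h)
    (fun h => le_sup_right (b := J) h)⟩
  obtain ⟨p, hp, q, hq, hpq⟩ := Submodule.mem_sup.1 h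
  have ha : a ∈ (p + q).support := by
    rw [hpq, mem_support_monomial_one]
  classical
  rcases Finset.mem_union.1 (support_add ha) with ha | ha
  · exact .inl (hI.monomial_mem hp ha)
  · exact .inr (hJ.monomial_mem hq ha)

/-- Sums of monomial ideals distribute over intersections. -/
theorem inf_sup_eq (hI : IsMonomialIdeal I) (hJ : IsMonomialIdeal J) (hL : IsMonomialIdeal L) :
    I ⊓ J ⊔ L = (I ⊔ L) ⊓ (J ⊔ L) := by
  refine ((hI.inf hJ).sup hL).ext ((hI.sup hL).inf (hJ.sup hL)) fun a => ?_
  rw [(hI.inf hJ).monomial_mem_sup_iff hL, Submodule.mem_inf, Submodule.mem_inf,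
    hI.monomial_mem_sup_iff hL, hJ.monomial_mem_sup_iff hL]
  tauto

/-- Intersections of monomial ideals distribute over sums. -/
theorem inf_sup_inf_eq (hI : IsMonomialIdeal I) (hJ : IsMonomialIdeal J)
    (hL : IsMonomialIdeal L) : I ⊓ J ⊔ I ⊓ L = I ⊓ (J ⊔ L) := by
  refine ((hI.inf hJ).sup (hI.inf hL)).ext (hI.inf (hJ.sup hL)) fun a => ?_
  rw [(hI.inf hJ).monomial_mem_sup_iff (hI.inf hL), Submodule.mem_inf, Submodule.mem_inf,
    Submodule.mem_inf, hJ.monomial_mem_sup_iff hL]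
  tauto

end IsMonomialIdeal

/-! ### Ideals generated by variables -/

variable (K) in
/-- The prime ideal generated by the variables with index in `A`. -/
def varIdeal (A : Finset (Fin n)) : Ideal (MvPolynomial (Fin n) K) :=
  Ideal.span (X '' (A : Set (Fin n)))

theorem X_mem_varIdeal_iff {i : Fin n} : (X i : MvPolynomial (Fin n) K) ∈ varIdeal K A ↔ i ∈ A := by
  rw [varIdeal, mem_ideal_span_X_image]
  have h : ∀ m, m ∈ (X i : MvPolynomial (Fin n) K).support ↔ m = Finsupp.single i 1 :=
    fun m => mem_support_monomial_one
  simp [h, Finsupp.single_apply]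

theorem varIdeal_le_varIdeal_iff : varIdeal K A ≤ varIdeal K A' ↔ A ⊆ A' := by
  refine ⟨fun h i hi => X_mem_varIdeal_iff.1 (h (X_mem_varIdeal_iff.2 hi)), fun h => ?_⟩
  exact Ideal.span_mono (Set.image_mono h)

theorem varIdeal_injective : Function.Injective (varIdeal K : Finset (Fin n) → _) :=
  fun _ _ h => Finset.Subset.antisymm (varIdeal_le_varIdeal_iff.1 h.le)
    (varIdeal_le_varIdeal_iff.1 h.ge)

theorem varIdeal_union : varIdeal K (A ∪ A') = varIdeal K A ⊔ varIdeal K A' := by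
  rw [varIdeal, Finset.coe_union, Set.image_union, Ideal.span_union]; rfl

theorem varIdeal_univ : varIdeal K (Finset.univ : Finset (Fin n)) = idealOfVars (Fin n) K := by
  rw [varIdeal, Finset.coe_univ, Set.image_univ]

theorem varIdeal_le_idealOfVars : varIdeal K A ≤ idealOfVars (Fin n) K :=
  varIdeal_univ (K := K) ▸ varIdeal_le_varIdeal_iff.2 (Finset.subset_univ A)

/-- `varIdeal K A` is the kernel of the evaluation sending the variables of `A` to zero. -/
theorem varIdeal_eq_ker : varIdeal K A = RingHom.ker
    (aeval fun i => if i ∈ A then 0 else X i :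
      MvPolynomial (Fin n) K →ₐ[K] MvPolynomial (Fin n) K) := by
  apply le_antisymm
  · rw [varIdeal, Ideal.span_le]
    rintro _ ⟨i, hi, rfl⟩
    have hi' : i ∈ A := hi
    simp [RingHom.mem_ker, hi']
  · intro p hp
    have h : (Ideal.Quotient.mkₐ K (varIdeal K A)).comp
        (aeval fun i => if i ∈ A then 0 else X i) = Ideal.Quotient.mkₐ K (varIdeal K A) := by
      ext i
      by_cases hi : i ∈ A
      · simpa [hi] using (Ideal.Quotient.eq_zero_iff_mem.2 (X_mem_varIdeal_iff.2 hi)).symm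
      · simp [hi]
    have := congrArg (· p) h
    simp only [AlgHom.comp_apply] at this
    rw [RingHom.mem_ker.1 hp, map_zero] at this
    exact Ideal.Quotient.eq_zero_iff_mem.1 this.symm

instance varIdeal_isPrime : (varIdeal K A).IsPrime := by
  rw [varIdeal_eq_ker]
  exact RingHom.ker_isPrime _

instance idealOfVars_isMaximal : (idealOfVars (Fin n) K).IsMaximal := by
  have h : idealOfVars (Fin n) K = RingHom.ker (constantCoeff : MvPolynomial (Fin n) K →+* K) := by
    ext p
    rw [← pow_one (idealOfVars (Fin n) K), mem_pow_idealOfVars_iff', RingHom.mem_ker]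
    simp [constantCoeff_eq, Finsupp.degree_eq_zero_iff]
  rw [h]
  exact RingHom.ker_isMaximal_of_surjective _ fun x => ⟨C x, by simp⟩

section Dimension

theorem ringKrullDim_varIdeal_insert_add_one_le {j : Fin n} (hj : j ∉ A) :
    ringKrullDim (MvPolynomial (Fin n) K ⧸ varIdeal K (insert j A)) + 1 ≤
      ringKrullDim (MvPolynomial (Fin n) K ⧸ varIdeal K A) :=
  ringKrullDim_quotient_add_one_le_of_lt <| lt_of_le_not_ge
    (varIdeal_le_varIdeal_iff.2 (Finset.subset_insert j A))
    fun h => hj (varIdeal_le_varIdeal_iff.1 h (Finset.mem_insert_self j A))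

theorem ringKrullDim_varIdeal_add_card_le :
    ringKrullDim (MvPolynomial (Fin n) K ⧸ varIdeal K A) + A.card ≤ n := by
  induction A using Finset.induction_on with
  | empty =>
    rw [Finset.card_empty, Nat.cast_zero, add_zero]
    refine (ringKrullDim_quotient_le _).trans ?_
    rw [MvPolynomial.ringKrullDim_of_isNoetherianRing]
    simp
  | insert j A hj ih =>
    refine le_trans ?_ ih
    rw [Finset.card_insert_of_notMem hj, Nat.cast_succ, add_comm (A.card : WithBot ℕ∞), ← add_assoc]
    gcongr
    exact ringKrullDim_varIdeal_insert_add_one_le hj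

theorem card_compl_le_ringKrullDim_varIdeal :
    (Aᶜ.card : WithBot ℕ∞) ≤ ringKrullDim (MvPolynomial (Fin n) K ⧸ varIdeal K A) := by
  induction hk : Aᶜ.card generalizing A with
  | zero => simpa using ringKrullDim_nonneg_of_nontrivial
  | succ k ih =>
    obtain ⟨j, hj⟩ : Aᶜ.Nonempty := Finset.card_pos.1 (by omega)
    rw [Finset.mem_compl] at hj
    refine le_trans ?_ (ringKrullDim_varIdeal_insert_add_one_le hj)
    rw [Nat.cast_succ]
    gcongr
    refine ih ?_
    rw [Finset.compl_insert, Finset.card_erase_of_mem (Finset.mem_compl.2 hj), hk,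
      Nat.add_sub_cancel]

theorem ringKrullDim_varIdeal :
    ringKrullDim (MvPolynomial (Fin n) K ⧸ varIdeal K A) = (Aᶜ.card : ℕ) := by
  refine le_antisymm ?_ card_compl_le_ringKrullDim_varIdeal
  have h := ringKrullDim_varIdeal_add_card_le (K := K) (A := A)
  have hc : A.card + Aᶜ.card = n := by simp [Finset.card_add_card_compl]
  obtain ⟨d, hd⟩ : ∃ d : ℕ∞, ringKrullDim (MvPolynomial (Fin n) K ⧸ varIdeal K A) = d := by
    refine ⟨_, (WithBot.coe_unbot _ fun hbot => ?_).symm⟩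
    exact absurd (hbot ▸ ringKrullDim_nonneg_of_nontrivial
      (R := MvPolynomial (Fin n) K ⧸ varIdeal K A))
      (by simp)
  rw [hd] at h ⊢
  have h' : d + A.card ≤ (A.card + Aᶜ.card : ℕ) := by
    rw [hc]; exact_mod_cast h
  have : d ≠ ⊤ := by rintro rfl; simp at h'
  lift d to ℕ using this
  norm_cast at h' ⊢
  omega

theorem height_varIdeal : (varIdeal K A).height = A.card := by
  apply le_antisymm
  · have hfin := A.finite_toSet.image (X : Fin n → MvPolynomial (Fin n) K)
    refine (Ideal.height_le_card_of_mem_minimalPrimes_span hfin ?_).trans ?_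
    · change varIdeal K A ∈ (varIdeal K A).minimalPrimes
      rw [Ideal.minimalPrimes_eq_subsingleton_self]
      exact Set.mem_singleton _
    · exact_mod_cast (Set.ncard_image_le A.finite_toSet).trans_eq (Set.ncard_coe_finset A)
  · induction A using Finset.induction_on with
    | empty => simp
    | insert j A hj ih =>
      rw [Finset.card_insert_of_notMem hj, Nat.cast_succ]
      refine le_trans (by gcongr) (Ideal.height_add_one_le_of_lt_of_isPrime
        (I := varIdeal K A) (J := varIdeal K (insert j A)) ?_)
      exact lt_of_le_not_ge (varIdeal_le_varIdeal_iff.2 (Finset.subset_insert j A))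
        fun h => hj (varIdeal_le_varIdeal_iff.1 h (Finset.mem_insert_self j A))

end Dimension

/-! ### Monomial primary ideals -/

theorem exists_mem_notMem_forall_mul_mem {R : Type*} [CommRing R] [IsNoetherianRing R]
    {P J Q : Ideal R} (hP : P ≤ Q.radical) (hJ : ¬ J ≤ Q) :
    ∃ f ∈ J, f ∉ Q ∧ ∀ x ∈ P, x * f ∈ Q := by
  obtain ⟨N, hN⟩ := Ideal.exists_pow_le_of_le_radical_of_fg hP (IsNoetherian.noetherian P)
  -- the last power of `P` whose product with `J` is not contained in `Q`
  obtain ⟨k, hk, hk'⟩ : ∃ k, ¬ P ^ k * J ≤ Q ∧ P ^ (k + 1) * J ≤ Q := by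
    by_contra! h
    have hall : ∀ k, ¬ P ^ k * J ≤ Q := fun k => by
      induction k with
      | zero => rwa [pow_zero, one_mul]
      | succ k ih => exact h k ih
    exact hall N (Ideal.mul_le_left.trans hN)
  rw [pow_succ', mul_assoc] at hk'
  obtain ⟨f, hf, hfQ⟩ := SetLike.not_le_iff_exists.1 hk
  exact ⟨f, Ideal.mul_le_right hf, hfQ, fun x hx => hk' (Ideal.mul_mem_mul hx hf)⟩

/-- `Q` is a proper monomial ideal that is primary to the prime ideal generated by the variables
indexed by `A`, in combinatorial form: `Q` contains a power of each variable of `A`, and membership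
of a monomial in `Q` depends only on its part in the variables of `A`. -/
structure IsMonomialPrimaryTo (A : Finset (Fin n)) (Q : Ideal (MvPolynomial (Fin n) K)) :
    Prop where
  isMonomialIdeal : IsMonomialIdeal Q
  ne_top : Q ≠ ⊤
  X_mem_radical : ∀ i ∈ A, X i ∈ Q.radical
  filter_mem : ∀ a, monomial a (1 : K) ∈ Q → monomial (a.filter (· ∈ A)) (1 : K) ∈ Q

theorem monomial_mem_of_le {a b : Fin n →₀ ℕ} (hab : a ≤ b) (ha : monomial a (1 : K) ∈ I) :
    monomial b (1 : K) ∈ I :=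
  I.mem_of_dvd (monomial_dvd_monomial.2 ⟨.inr hab, one_dvd _⟩) ha

theorem Finsupp.filter_le {ι : Type*} (a : ι →₀ ℕ) (p : ι → Prop) [DecidablePred p] :
    a.filter p ≤ a := by
  intro i
  rw [Finsupp.filter_apply]
  split <;> simp

/-- A primary monomial ideal is determined by the variables in its radical. -/
theorem exists_isMonomialPrimaryTo (hQ : IsMonomialIdeal Q) (hQ' : Q.IsPrimary) :
    ∃ A : Finset (Fin n), IsMonomialPrimaryTo A Q := by
  classical
  let A : Finset (Fin n) := Finset.univ.filter fun i => X i ∈ Q.radical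
  have hprime := Ideal.isPrime_radical hQ'
  refine ⟨A, hQ, hQ'.1, by simp [A], fun a ha => ?_⟩
  have hsplit : monomial (a.filter (· ∈ A)) (1 : K) * monomial (a.filter (¬ · ∈ A)) 1 ∈ Q := by
    rwa [monomial_mul, Finsupp.filter_add_filter_not, mul_one]
  refine ((Ideal.isPrimary_iff.1 hQ').2 hsplit).resolve_right fun h => ?_
  rw [monomial_eq, Finsupp.prod, map_one, one_mul, hprime.prod_mem_iff] at h
  obtain ⟨i, hi, hiQ⟩ := h
  have hiA : i ∈ A := by simpa [A] using hprime.mem_of_pow_mem _ hiQ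
  simp [hiA] at hi

namespace IsMonomialPrimaryTo

theorem mem_iff (hQ : IsMonomialPrimaryTo A Q) {a : Fin n →₀ ℕ} :
    monomial a (1 : K) ∈ Q ↔ monomial (a.filter (· ∈ A)) (1 : K) ∈ Q :=
  ⟨hQ.filter_mem a, monomial_mem_of_le (Finsupp.filter_le a _)⟩

theorem one_notMem (hQ : IsMonomialPrimaryTo A Q) : monomial 0 (1 : K) ∉ Q :=
  fun h => hQ.ne_top ((Ideal.eq_top_iff_one _).2 h)

theorem sup (hQ : IsMonomialPrimaryTo A Q) (hQ' : IsMonomialPrimaryTo A' Q') :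
    IsMonomialPrimaryTo (A ∪ A') (Q ⊔ Q') where
  isMonomialIdeal := hQ.isMonomialIdeal.sup hQ'.isMonomialIdeal
  ne_top h := by
    have h1 : monomial 0 (1 : K) ∈ Q ⊔ Q' := h ▸ trivial
    rw [hQ.isMonomialIdeal.monomial_mem_sup_iff hQ'.isMonomialIdeal] at h1
    exact h1.elim hQ.one_notMem hQ'.one_notMem
  X_mem_radical i hi := by
    rcases Finset.mem_union.1 hi with hi | hi
    · exact Ideal.radical_mono le_sup_left (hQ.X_mem_radical i hi)
    · exact Ideal.radical_mono le_sup_right (hQ'.X_mem_radical i hi)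
  filter_mem a ha := by
    have key : ∀ B ⊆ A ∪ A', a.filter (· ∈ B) ≤ a.filter (· ∈ A ∪ A') := by
      intro B hB i
      by_cases hi : i ∈ B
      · rw [Finsupp.filter_apply_pos (· ∈ B) _ hi, Finsupp.filter_apply_pos (· ∈ A ∪ A') _ (hB hi)]
      · rw [Finsupp.filter_apply_neg (· ∈ B) _ hi]; exact Nat.zero_le _
    rw [hQ.isMonomialIdeal.monomial_mem_sup_iff hQ'.isMonomialIdeal] at ha ⊢
    exact ha.imp
      (fun h => monomial_mem_of_le (key A Finset.subset_union_left) (hQ.filter_mem a h))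
      (fun h => monomial_mem_of_le (key A' Finset.subset_union_right) (hQ'.filter_mem a h))

theorem span_X (j : Fin n) :
    IsMonomialPrimaryTo {j} (Ideal.span {(X j : MvPolynomial (Fin n) K)}) where
  isMonomialIdeal := ⟨{Finsupp.single j 1}, by rw [Set.image_singleton]; rfl⟩
  ne_top h := by
    have h2 : varIdeal K {j} ≠ ⊤ := varIdeal_isPrime.ne_top
    rw [varIdeal, Finset.coe_singleton, Set.image_singleton] at h2
    exact h2 h
  X_mem_radical i hi := by
    rw [Finset.mem_singleton.1 hi]
    exact Ideal.le_radical (Ideal.mem_span_singleton_self _)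
  filter_mem a ha := by
    rw [Ideal.mem_span_singleton, X_dvd_monomial] at ha ⊢
    refine .inr ?_
    rw [Finsupp.filter_apply_pos _ _ (Finset.mem_singleton_self j)]
    exact ha.resolve_left one_ne_zero

theorem le_varIdeal (hQ : IsMonomialPrimaryTo A Q) : Q ≤ varIdeal K A := by
  refine hQ.isMonomialIdeal.le_iff.2 fun a ha => ?_
  rw [varIdeal, mem_ideal_span_X_image]
  intro b hb
  obtain rfl := mem_support_monomial_one.1 hb
  by_contra! h
  refine hQ.one_notMem ?_
  have : b.filter (· ∈ A) = 0 := by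
    ext i
    by_cases hi : i ∈ A
    · rw [Finsupp.filter_apply_pos (· ∈ A) _ hi, h i hi]; rfl
    · rw [Finsupp.filter_apply_neg (· ∈ A) _ hi]; rfl
  exact this ▸ hQ.filter_mem b ha

theorem varIdeal_le_radical (hQ : IsMonomialPrimaryTo A Q) : varIdeal K A ≤ Q.radical := by
  rw [varIdeal, Ideal.span_le]
  rintro _ ⟨i, hi, rfl⟩
  exact hQ.X_mem_radical i hi

theorem radical_eq (hQ : IsMonomialPrimaryTo A Q) : Q.radical = varIdeal K A :=
  le_antisymm (varIdeal_isPrime.radical_le_iff.2 hQ.le_varIdeal) hQ.varIdeal_le_radical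

theorem le_idealOfVars (hQ : IsMonomialPrimaryTo A Q) : Q ≤ idealOfVars (Fin n) K :=
  hQ.le_varIdeal.trans varIdeal_le_idealOfVars

theorem height_eq (hQ : IsMonomialPrimaryTo A Q) : Q.height = A.card := by
  rw [← height_varIdeal (K := K), ← hQ.radical_eq, Ideal.height_eq_inf_minimalPrimes,
    Ideal.height_eq_inf_minimalPrimes, Ideal.radical_minimalPrimes]

theorem isSMulRegular_X (hQ : IsMonomialPrimaryTo A Q) {j : Fin n} (hj : j ∉ A) :
    IsSMulRegular (MvPolynomial (Fin n) K ⧸ Q) (X j : MvPolynomial (Fin n) K) := by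
  refine (isSMulRegular_quotient_iff_mem_of_smul_mem _ _).2 fun p hp => ?_
  refine Ideal.mem_of_forall_monomial_mem fun a ha => ?_
  rw [smul_eq_mul] at hp
  have h : monomial (a + Finsupp.single j 1) (1 : K) ∈ Q := by
    refine hQ.isMonomialIdeal.monomial_mem hp ?_
    rw [mem_support_iff, mul_comm, coeff_mul_X]
    exact mem_support_iff.1 ha
  rw [hQ.mem_iff, Finsupp.filter_add, Finsupp.filter_single_of_neg _ hj, add_zero] at h
  exact hQ.mem_iff.2 h

/-- The quotient by a monomial primary ideal is Cohen-Macaulay: the variables outside `A` form a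
regular sequence. -/
theorem depthAtLeast (hQ : IsMonomialPrimaryTo A Q) :
    DepthAtLeast (idealOfVars (Fin n) K) (MvPolynomial (Fin n) K ⧸ Q) Aᶜ.card := by
  induction hk : Aᶜ.card generalizing A Q with
  | zero => exact fun i hi => absurd hi (Nat.not_lt_zero i)
  | succ k ih =>
    obtain ⟨j, hj⟩ : Aᶜ.Nonempty := Finset.card_pos.1 (by omega)
    rw [Finset.mem_compl] at hj
    refine .of_isSMulRegular (Ideal.IsMaximal.ne_top inferInstance) hQ.le_idealOfVars
      (Ideal.subset_span ⟨j, rfl⟩) (hQ.isSMulRegular_X hj) (ih (hQ.sup (span_X j)) ?_)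
    rw [Finset.union_comm, ← Finset.insert_eq, Finset.compl_insert,
      Finset.card_erase_of_mem (Finset.mem_compl.2 hj), hk, Nat.add_sub_cancel]

/-- If the monomial ideal `J` is not contained in `Q`, then `J \ Q` contains a monomial that is
multiplied into `Q` by all variables of `A`. -/
theorem exists_monomial_socle (hQ : IsMonomialPrimaryTo A Q) (hJ : IsMonomialIdeal J)
    (hJQ : ¬ J ≤ Q) : ∃ w : Fin n →₀ ℕ, monomial w (1 : K) ∈ J ∧ monomial w (1 : K) ∉ Q ∧
      ∀ i ∈ A, monomial (w + Finsupp.single i 1) (1 : K) ∈ Q := by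
  obtain ⟨p, hpJ, hpQ, hp⟩ := exists_mem_notMem_forall_mul_mem hQ.varIdeal_le_radical hJQ
  obtain ⟨w, hw, hwQ⟩ : ∃ w ∈ p.support, monomial w (1 : K) ∉ Q := by
    by_contra! h
    exact hpQ (Ideal.mem_of_forall_monomial_mem h)
  refine ⟨w, hJ.monomial_mem hpJ hw, hwQ, fun i hi => ?_⟩
  refine hQ.isMonomialIdeal.monomial_mem (hp _ (X_mem_varIdeal_iff.2 hi)) ?_
  rw [mem_support_iff, mul_comm, coeff_mul_X]
  exact mem_support_iff.1 hw

theorem isAssociatedPrime (hQ : IsMonomialPrimaryTo A Q) (hJ : IsMonomialIdeal J)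
    (hJQ : ¬ J ≤ Q) : IsAssociatedPrime (varIdeal K A) (MvPolynomial (Fin n) K ⧸ Q ⊓ J) := by
  obtain ⟨w, hwJ, hwQ, hw⟩ := hQ.exists_monomial_socle hJ hJQ
  refine isAssociatedPrime_iff.2 ⟨varIdeal_isPrime, Submodule.Quotient.mk (monomial w 1), ?_⟩
  ext p
  rw [Submodule.mem_colon_singleton, Submodule.mem_bot, ← Submodule.Quotient.mk_smul,
    Submodule.Quotient.mk_eq_zero, smul_eq_mul, Submodule.mem_inf,
    and_iff_left (J.mul_mem_left p hwJ)]
  constructor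
  · intro hp
    suffices h : varIdeal K A ≤ Q.colon {monomial w (1 : K)} by
      simpa [Submodule.mem_colon_singleton] using h hp
    rw [varIdeal, Ideal.span_le]
    rintro _ ⟨i, hi, rfl⟩
    have := hw i hi
    rw [SetLike.mem_coe, Submodule.mem_colon_singleton, smul_eq_mul, mul_comm, X, monomial_mul,
      mul_one]
    exact this
  · intro hp
    rw [varIdeal, mem_ideal_span_X_image]
    intro a ha
    by_contra! h
    have h1 : monomial (a + w) (1 : K) ∈ Q := by
      refine hQ.isMonomialIdeal.monomial_mem hp ?_
      rw [mem_support_iff, coeff_mul_monomial, mul_one]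
      exact mem_support_iff.1 ha
    have h2 : a.filter (· ∈ A) = 0 := by
      ext i
      by_cases hi : i ∈ A
      · rw [Finsupp.filter_apply_pos (· ∈ A) _ hi, h i hi]; rfl
      · rw [Finsupp.filter_apply_neg (· ∈ A) _ hi]; rfl
    rw [hQ.mem_iff, Finsupp.filter_add, h2, zero_add, ← hQ.mem_iff] at h1
    exact hwQ h1

/-- A component of a monomial ideal that is not superfluous bounds the depth by its dimension. -/
theorem le_card_compl (hQ : IsMonomialPrimaryTo A Q) (hJ : IsMonomialIdeal J) (hJQ : ¬ J ≤ Q)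
    {r : ℕ} (h : DepthAtLeast (idealOfVars (Fin n) K) (MvPolynomial (Fin n) K ⧸ Q ⊓ J) r) :
    r ≤ Aᶜ.card := by
  have h1 := h.le_ringKrullDim (inf_le_left.trans hQ.le_idealOfVars)
    (hQ.isAssociatedPrime hJ hJQ) varIdeal_le_idealOfVars
  rw [ringKrullDim_varIdeal] at h1
  exact_mod_cast h1

end IsMonomialPrimaryTo

end MonomialIdeal

/-! ### Intersections of two monomial primary ideals -/

noncomputable section ThreeComponents

variable {K : Type u} [Field K] {n : ℕ} {I J Q₁ Q₂ Q₃ : Ideal (MvPolynomial (Fin n) K)}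
  {A₁ A₂ A₃ : Finset (Fin n)}

/-- `S/I` has depth at least `r` with respect to the graded maximal ideal of the polynomial ring
`S`. -/
abbrev DepthQuotAtLeast (I : Ideal (MvPolynomial (Fin n) K)) (r : ℕ) : Prop :=
  DepthAtLeast (idealOfVars (Fin n) K) (MvPolynomial (Fin n) K ⧸ I) r

theorem depthQuot_eq (hI : I ≤ idealOfVars (Fin n) K) {d : ℕ}
    (h : DepthQuotAtLeast I d) (h' : ¬ DepthQuotAtLeast I (d + 1)) : depthQuot I = d :=
  depthIn_quotient_eq (Ideal.IsMaximal.ne_top inferInstance) hI h h'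

theorem card_compl_le_of_subset {A B : Finset (Fin n)} (h : A ⊆ B) : Bᶜ.card ≤ Aᶜ.card :=
  Finset.card_le_card (Finset.compl_subset_compl.2 h)

theorem card_compl_lt_of_not_subset {A B : Finset (Fin n)} (h : A ⊆ B) (h' : ¬ B ⊆ A) :
    Bᶜ.card < Aᶜ.card :=
  Finset.card_lt_card ⟨Finset.compl_subset_compl.2 h,
    fun hc => h' (Finset.compl_subset_compl.1 hc)⟩

theorem IsMonomialPrimaryTo.depthAtLeast_iff {r : ℕ} (h₁ : IsMonomialPrimaryTo A₁ Q₁) :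
    DepthQuotAtLeast Q₁ r ↔ r ≤ A₁ᶜ.card := by
  refine ⟨fun h => h₁.le_card_compl .top (fun hle => h₁.ne_top (top_le_iff.1 hle)) ?_,
    fun h => h₁.depthAtLeast.mono h⟩
  rwa [inf_top_eq]

section Two

theorem depthQuotAtLeast_inf (h₁ : IsMonomialPrimaryTo A₁ Q₁) (h₂ : IsMonomialPrimaryTo A₂ Q₂)
    {r : ℕ} (hr₁ : r ≤ A₁ᶜ.card) (hr₂ : r ≤ A₂ᶜ.card) (hr₁₂ : r ≤ (A₁ ∪ A₂)ᶜ.card + 1) :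
    DepthQuotAtLeast (Q₁ ⊓ Q₂) r :=
  .quotient_inf (h₁.depthAtLeast_iff.2 hr₁) (h₂.depthAtLeast_iff.2 hr₂)
    (h₁.sup h₂).depthAtLeast hr₁₂

theorem not_depthQuotAtLeast_inf (h₁ : IsMonomialPrimaryTo A₁ Q₁)
    (h₂ : IsMonomialPrimaryTo A₂ Q₂) (h₁₂ : ¬ A₁ ⊆ A₂) (h₂₁ : ¬ A₂ ⊆ A₁) :
    ¬ DepthQuotAtLeast (Q₁ ⊓ Q₂) ((A₁ ∪ A₂)ᶜ.card + 1 + 1) := by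
  intro h
  have hlt₁ : (A₁ ∪ A₂)ᶜ.card < A₁ᶜ.card := card_compl_lt_of_not_subset Finset.subset_union_left
    fun hs => h₂₁ (Finset.subset_union_right.trans hs)
  have hlt₂ : (A₁ ∪ A₂)ᶜ.card < A₂ᶜ.card := card_compl_lt_of_not_subset Finset.subset_union_right
    fun hs => h₁₂ (Finset.subset_union_left.trans hs)
  have := (h₁.sup h₂).depthAtLeast_iff.1
    (DepthAtLeast.quotient_sup (h₁.depthAtLeast_iff.2 hlt₁) (h₂.depthAtLeast_iff.2 hlt₂) h)
  omega

end Two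

/-! ### The case of a component contained in the sum of the others -/

section Fork

variable (h₁ : IsMonomialPrimaryTo A₁ Q₁) (h₂ : IsMonomialPrimaryTo A₂ Q₂)
  (h₃ : IsMonomialPrimaryTo A₃ Q₃)

include h₁ h₂ h₃

/-- If `Q₁ ⊆ Q₂ + Q₃`, then `S/(Q₁ ∩ Q₂ ∩ Q₃)` is the fibre product of `S/(Q₁ ∩ Q₂)` and
`S/(Q₁ ∩ Q₃)` over `S/Q₁`, and its depth is the smaller one of the depths of these two rings as long
as that number is at most `dim S/Q₁`. -/
theorem depthQuot_eq_of_le_sup (hle : Q₁ ≤ Q₂ ⊔ Q₃) (hirr : ¬ Q₂ ⊓ Q₃ ≤ Q₁) {b : ℕ}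
    (h₁₂ : DepthQuotAtLeast (Q₁ ⊓ Q₂) b) (h₁₃ : DepthQuotAtLeast (Q₁ ⊓ Q₃) b)
    (hb : ¬ DepthQuotAtLeast (Q₁ ⊓ Q₂) (b + 1) ∨ ¬ DepthQuotAtLeast (Q₁ ⊓ Q₃) (b + 1))
    (hb₁ : b ≤ A₁ᶜ.card) : depthQuot (Q₁ ⊓ Q₂ ⊓ Q₃) = b := by
  have hinf : Q₁ ⊓ Q₂ ⊓ (Q₁ ⊓ Q₃) = Q₁ ⊓ Q₂ ⊓ Q₃ := by
    rw [inf_inf_distrib_left Q₁ Q₂ Q₃ |>.symm, inf_assoc]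
  have hsup : Q₁ ⊓ Q₂ ⊔ Q₁ ⊓ Q₃ = Q₁ := by
    rw [h₁.isMonomialIdeal.inf_sup_inf_eq h₂.isMonomialIdeal h₃.isMonomialIdeal,
      inf_eq_left.2 hle]
  rw [← hinf]
  refine depthQuot_eq (inf_le_left.trans (inf_le_left.trans h₁.le_idealOfVars)) ?_ fun h => ?_
  · refine .quotient_inf h₁₂ h₁₃ (s := A₁ᶜ.card) ?_ (by omega)
    rw [hsup]
    exact h₁.depthAtLeast
  · have hlt : b + 1 ≤ A₁ᶜ.card := by
      refine h₁.le_card_compl (h₂.isMonomialIdeal.inf h₃.isMonomialIdeal) hirr ?_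
      rwa [← inf_assoc, ← hinf]
    have := DepthAtLeast.of_quotient_inf_of_quotient_sup h (by
      rw [hsup]; exact h₁.depthAtLeast_iff.2 hlt)
    tauto

theorem depthQuot_eq_one_add_min (hle : Q₁ ≤ Q₂ ⊔ Q₃) (hirr : ¬ Q₂ ⊓ Q₃ ≤ Q₁)
    (h₁₂ : ¬ A₁ ⊆ A₂) (h₁₃ : ¬ A₁ ⊆ A₃) (hA : ¬ A₂ ∪ A₃ ⊆ A₁) :
    depthQuot (Q₁ ⊓ Q₂ ⊓ Q₃) = (1 + min (A₁ ∪ A₂)ᶜ.card (A₁ ∪ A₃)ᶜ.card : ℕ) := by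
  have hlt₂ : (A₁ ∪ A₂)ᶜ.card < A₂ᶜ.card := card_compl_lt_of_not_subset Finset.subset_union_right
    fun hs => h₁₂ (Finset.subset_union_left.trans hs)
  have hlt₃ : (A₁ ∪ A₃)ᶜ.card < A₃ᶜ.card := card_compl_lt_of_not_subset Finset.subset_union_right
    fun hs => h₁₃ (Finset.subset_union_left.trans hs)
  have hle₂ : (A₁ ∪ A₂)ᶜ.card ≤ A₁ᶜ.card := card_compl_le_of_subset Finset.subset_union_left
  have hle₃ : (A₁ ∪ A₃)ᶜ.card ≤ A₁ᶜ.card := card_compl_le_of_subset Finset.subset_union_left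
  have hlt₂' : ¬ A₂ ⊆ A₁ → (A₁ ∪ A₂)ᶜ.card < A₁ᶜ.card := fun h =>
    card_compl_lt_of_not_subset Finset.subset_union_left
      fun hs => h (Finset.subset_union_right.trans hs)
  have hlt₃' : ¬ A₃ ⊆ A₁ → (A₁ ∪ A₃)ᶜ.card < A₁ᶜ.card := fun h =>
    card_compl_lt_of_not_subset Finset.subset_union_left
      fun hs => h (Finset.subset_union_right.trans hs)
  have heq₂ : A₂ ⊆ A₁ → (A₁ ∪ A₂)ᶜ.card = A₁ᶜ.card := fun h => by
    rw [Finset.union_eq_left.2 h]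
  have heq₃ : A₃ ⊆ A₁ → (A₁ ∪ A₃)ᶜ.card = A₁ᶜ.card := fun h => by
    rw [Finset.union_eq_left.2 h]
  have hor : ¬ A₂ ⊆ A₁ ∨ ¬ A₃ ⊆ A₁ := by
    by_contra! h
    exact hA (Finset.union_subset h.1 h.2)
  have hb₁ : 1 + min (A₁ ∪ A₂)ᶜ.card (A₁ ∪ A₃)ᶜ.card ≤ A₁ᶜ.card := by
    rcases hor with h | h
    · have := hlt₂' h; omega
    · have := hlt₃' h; omega
  refine depthQuot_eq_of_le_sup h₁ h₂ h₃ hle hirr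
    (depthQuotAtLeast_inf h₁ h₂ hb₁ (by omega) (by omega))
    (depthQuotAtLeast_inf h₁ h₃ hb₁ (by omega) (by omega)) ?_ hb₁
  rcases le_total (A₁ ∪ A₂)ᶜ.card (A₁ ∪ A₃)ᶜ.card with hmin | hmin
  · left
    rw [min_eq_left hmin, add_comm 1]
    refine not_depthQuotAtLeast_inf h₁ h₂ h₁₂ fun h => ?_
    have := hlt₃' (hor.resolve_left (not_not.2 h))
    have := heq₂ h
    omega
  · right
    rw [min_eq_right hmin, add_comm 1]
    refine not_depthQuotAtLeast_inf h₁ h₃ h₁₃ fun h => ?_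
    have := hlt₂' (hor.resolve_right (not_not.2 h))
    have := heq₃ h
    omega

theorem depthQuot_eq_min_one_add (hle : Q₁ ≤ Q₂ ⊔ Q₃) (hirr₁ : ¬ Q₂ ⊓ Q₃ ≤ Q₁)
    (hirr₂ : ¬ Q₁ ⊓ Q₃ ≤ Q₂) (h₁₂ : A₁ ⊆ A₂) (h₁₃ : ¬ A₁ ⊆ A₃) :
    depthQuot (Q₁ ⊓ Q₂ ⊓ Q₃) = (min A₂ᶜ.card (1 + (A₁ ∪ A₃)ᶜ.card) : ℕ) := by
  have hle₂ := card_compl_le_of_subset h₁₂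
  have hlt₃ : (A₁ ∪ A₃)ᶜ.card < A₃ᶜ.card := card_compl_lt_of_not_subset Finset.subset_union_right
    fun hs => h₁₃ (Finset.subset_union_left.trans hs)
  have hU : A₁ ∪ A₂ = A₂ := Finset.union_eq_right.2 h₁₂
  refine depthQuot_eq_of_le_sup h₁ h₂ h₃ hle hirr₁
    (depthQuotAtLeast_inf h₁ h₂ (by omega) (by omega) (by rw [hU]; omega))
    (depthQuotAtLeast_inf h₁ h₃ (by omega) (by omega) (by omega)) ?_ (by omega)
  rcases le_or_gt A₂ᶜ.card (1 + (A₁ ∪ A₃)ᶜ.card) with hmin | hmin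
  · left
    rw [min_eq_left hmin, inf_comm]
    intro h
    have := h₂.le_card_compl h₁.isMonomialIdeal (fun h => hirr₂ (inf_le_left.trans h)) h
    omega
  · right
    rw [min_eq_right hmin.le, add_comm 1]
    refine not_depthQuotAtLeast_inf h₁ h₃ h₁₃ fun h => ?_
    rw [Finset.union_eq_left.2 h] at hmin
    omega

theorem depthQuot_eq_min (hle : Q₁ ≤ Q₂ ⊔ Q₃) (hirr₁ : ¬ Q₂ ⊓ Q₃ ≤ Q₁)
    (hirr₂ : ¬ Q₁ ⊓ Q₃ ≤ Q₂) (hirr₃ : ¬ Q₁ ⊓ Q₂ ≤ Q₃) (h₁₂ : A₁ ⊆ A₂) (h₁₃ : A₁ ⊆ A₃) :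
    depthQuot (Q₁ ⊓ Q₂ ⊓ Q₃) = (min A₂ᶜ.card A₃ᶜ.card : ℕ) := by
  have hle₂ := card_compl_le_of_subset h₁₂
  have hle₃ := card_compl_le_of_subset h₁₃
  have hU₂ : A₁ ∪ A₂ = A₂ := Finset.union_eq_right.2 h₁₂
  have hU₃ : A₁ ∪ A₃ = A₃ := Finset.union_eq_right.2 h₁₃
  refine depthQuot_eq_of_le_sup h₁ h₂ h₃ hle hirr₁
    (depthQuotAtLeast_inf h₁ h₂ (by omega) (by omega) (by rw [hU₂]; omega))
    (depthQuotAtLeast_inf h₁ h₃ (by omega) (by omega) (by rw [hU₃]; omega)) ?_ (by omega)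
  rcases le_total A₂ᶜ.card A₃ᶜ.card with hmin | hmin
  · left
    rw [min_eq_left hmin, inf_comm]
    intro h
    have := h₂.le_card_compl h₁.isMonomialIdeal (fun h => hirr₂ (inf_le_left.trans h)) h
    omega
  · right
    rw [min_eq_right hmin, inf_comm]
    intro h
    have := h₃.le_card_compl h₁.isMonomialIdeal (fun h => hirr₃ (inf_le_left.trans h)) h
    omega

end Fork

/-! ### Depth and size -/

section Size

section

variable (h₁ : IsMonomialPrimaryTo A₁ Q₁) (h₂ : IsMonomialPrimaryTo A₂ Q₂)
  (h₃ : IsMonomialPrimaryTo A₃ Q₃)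

include h₁ h₂ h₃

/-- The lower bound comes from `Q₁ ∩ Q₂ + Q₃ = (Q₁ + Q₃) ∩ (Q₂ + Q₃)`. -/
theorem depthQuotAtLeast_inf_inf {r : ℕ}
    (hr₁ : r ≤ A₁ᶜ.card) (hr₂ : r ≤ A₂ᶜ.card) (hr₃ : r ≤ A₃ᶜ.card)
    (hr₁₂ : r ≤ (A₁ ∪ A₂)ᶜ.card + 1) (hr₁₃ : r ≤ (A₁ ∪ A₃)ᶜ.card + 1)
    (hr₂₃ : r ≤ (A₂ ∪ A₃)ᶜ.card + 1) (hr : r ≤ (A₁ ∪ A₂ ∪ A₃)ᶜ.card + 2) :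
    DepthQuotAtLeast (Q₁ ⊓ Q₂ ⊓ Q₃) r := by
  refine .quotient_inf (depthQuotAtLeast_inf h₁ h₂ hr₁ hr₂ hr₁₂) (h₃.depthAtLeast_iff.2 hr₃)
    (s := r - 1) ?_ (by omega)
  rw [h₁.isMonomialIdeal.inf_sup_eq h₂.isMonomialIdeal h₃.isMonomialIdeal]
  refine depthQuotAtLeast_inf (h₁.sup h₃) (h₂.sup h₃) (by omega) (by omega) ?_
  rw [← Finset.union_union_distrib_right]
  omega

/-- If `P₁ + P₂ = P₁ + P₂ + P₃` but `Q₃ ⊄ Q₁ + Q₂`, then `P₁ + P₂` is associated to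
`(Q₁ + Q₂) ∩ (Q₃ + Q₂) = Q₁ ∩ Q₃ + Q₂`, which bounds the depth of `S/(Q₁ ∩ Q₂ ∩ Q₃)`. -/
theorem not_depthQuotAtLeast_of_subset_union (hle : ¬ Q₃ ≤ Q₁ ⊔ Q₂) (hA : A₃ ⊆ A₁ ∪ A₂)
    (hA₁ : ¬ A₂ ⊆ A₁) (hA₂ : ¬ A₁ ⊆ A₂) (hA₃ : ¬ A₁ ∪ A₂ ⊆ A₃) :
    ¬ DepthQuotAtLeast (Q₁ ⊓ Q₃ ⊓ Q₂) ((A₁ ∪ A₂)ᶜ.card + 1 + 1) := by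
  intro h
  have hlt₁ : (A₁ ∪ A₂)ᶜ.card < A₁ᶜ.card := card_compl_lt_of_not_subset Finset.subset_union_left
    fun hs => hA₁ (Finset.subset_union_right.trans hs)
  have hlt₂ : (A₁ ∪ A₂)ᶜ.card < A₂ᶜ.card := card_compl_lt_of_not_subset Finset.subset_union_right
    fun hs => hA₂ (Finset.subset_union_left.trans hs)
  have hlt₃ : (A₁ ∪ A₂)ᶜ.card < A₃ᶜ.card := card_compl_lt_of_not_subset hA hA₃
  have hle₁₃ : (A₁ ∪ A₂)ᶜ.card ≤ (A₁ ∪ A₃)ᶜ.card :=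
    card_compl_le_of_subset (Finset.union_subset Finset.subset_union_left hA)
  have hsup := DepthAtLeast.quotient_sup
    (depthQuotAtLeast_inf h₁ h₃ hlt₁ hlt₃ (by omega)) (h₂.depthAtLeast_iff.2 hlt₂) h
  rw [h₁.isMonomialIdeal.inf_sup_eq h₃.isMonomialIdeal h₂.isMonomialIdeal] at hsup
  have := (h₁.sup h₂).le_card_compl (h₃.isMonomialIdeal.sup h₂.isMonomialIdeal)
    (fun h => hle (le_sup_left.trans h)) hsup
  omega

/-- If no two of the `Pᵢ` have the sum `P₁ + P₂ + P₃`, then the top cohomology of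
`S/(Q₁ + Q₂ + Q₃)` survives two connecting homomorphisms. -/
theorem not_depthQuotAtLeast_of_not_subset_union (hA₁ : ¬ A₁ ⊆ A₂ ∪ A₃) (hA₂ : ¬ A₂ ⊆ A₁ ∪ A₃)
    (hA₃ : ¬ A₃ ⊆ A₁ ∪ A₂) :
    ¬ DepthQuotAtLeast (Q₁ ⊓ Q₂ ⊓ Q₃) ((A₁ ∪ A₂ ∪ A₃)ᶜ.card + 2 + 1) := by
  intro h
  have hlt₁₂ : (A₁ ∪ A₂ ∪ A₃)ᶜ.card < (A₁ ∪ A₂)ᶜ.card :=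
    card_compl_lt_of_not_subset (by grind) (by grind)
  have hlt₁₃ : (A₁ ∪ A₂ ∪ A₃)ᶜ.card < (A₁ ∪ A₃)ᶜ.card :=
    card_compl_lt_of_not_subset (by grind) (by grind)
  have hlt₂₃ : (A₁ ∪ A₂ ∪ A₃)ᶜ.card < (A₂ ∪ A₃)ᶜ.card :=
    card_compl_lt_of_not_subset (by grind) (by grind)
  have hlt₁ : (A₁ ∪ A₂)ᶜ.card < A₁ᶜ.card :=
    card_compl_lt_of_not_subset (by grind) (by grind)
  have hlt₂ : (A₁ ∪ A₂)ᶜ.card < A₂ᶜ.card :=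
    card_compl_lt_of_not_subset (by grind) (by grind)
  have hlt₃ : (A₁ ∪ A₃)ᶜ.card < A₃ᶜ.card :=
    card_compl_lt_of_not_subset (by grind) (by grind)
  have hsup := DepthAtLeast.quotient_sup (r := (A₁ ∪ A₂ ∪ A₃)ᶜ.card + 2)
    (depthQuotAtLeast_inf h₁ h₂ (by omega) (by omega) (by omega))
    (h₃.depthAtLeast_iff.2 (by omega)) h
  rw [h₁.isMonomialIdeal.inf_sup_eq h₂.isMonomialIdeal h₃.isMonomialIdeal] at hsup
  have hnot := not_depthQuotAtLeast_inf (h₁.sup h₃) (h₂.sup h₃) (by grind) (by grind)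
  rw [← Finset.union_union_distrib_right] at hnot
  exact hnot hsup

end

variable {s : ℕ} {Q : Fin s → Ideal (MvPolynomial (Fin n) K)} {A : Fin s → Finset (Fin n)}

theorem isMonomialPrimaryTo_biSup (hQ : ∀ i, IsMonomialPrimaryTo (A i) (Q i))
    {J : Finset (Fin s)} (hJ : J.Nonempty) :
    IsMonomialPrimaryTo (J.biUnion A) (⨆ j ∈ J, Q j) := by
  induction hJ using Finset.Nonempty.cons_induction with
  | singleton i => simpa using hQ i
  | cons i J hi hJ ih =>
    rw [Finset.cons_eq_insert, Finset.biUnion_insert, Finset.iSup_insert]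
    exact (hQ i).sup ih

/-- The radicals of the partial sums are determined by unions of sets of variables, so
`radicalCoverNumber` is a covering number. -/
theorem radicalCoverNumber_eq (hQ : ∀ i, IsMonomialPrimaryTo (A i) (Q i)) {v : ℕ}
    {J : Finset (Fin s)} (hJ : J.Nonempty) (hJv : J.card = v)
    (hJA : J.biUnion A = Finset.univ.biUnion A)
    (hv : ∀ J : Finset (Fin s), J.Nonempty → J.biUnion A = Finset.univ.biUnion A → v ≤ J.card) :
    radicalCoverNumber Q = v := by
  have key : ∀ J : Finset (Fin s), J.Nonempty → ((⨆ j ∈ J, Q j).radical = (⨆ j, Q j).radical ↔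
      J.biUnion A = Finset.univ.biUnion A) := by
    intro J hJ
    have huniv : (Finset.univ : Finset (Fin s)).Nonempty := hJ.mono (Finset.subset_univ J)
    have h := (isMonomialPrimaryTo_biSup hQ huniv).radical_eq
    simp only [Finset.mem_univ, iSup_pos] at h
    rw [(isMonomialPrimaryTo_biSup hQ hJ).radical_eq, h, varIdeal_injective.eq_iff]
  refine le_antisymm (Nat.sInf_le ⟨J, hJ, hJv, (key J hJ).2 hJA⟩) ?_
  refine le_csInf ⟨v, J, hJ, hJv, (key J hJ).2 hJA⟩ ?_
  rintro _ ⟨J', hJ', rfl, h⟩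
  exact hv J' hJ' ((key J' hJ').1 h)

end Size

section Family

variable {Q : Fin 3 → Ideal (MvPolynomial (Fin n) K)} {A : Fin 3 → Finset (Fin n)}

theorem iInf_eq_inf_of_fin_three {α : Type*} [CompleteLattice α] (f : Fin 3 → α) {i j k : Fin 3}
    (h : ∀ l, l = i ∨ l = j ∨ l = k) : ⨅ l, f l = f i ⊓ f j ⊓ f k := by
  refine le_antisymm (le_inf (le_inf (iInf_le _ _) (iInf_le _ _)) (iInf_le _ _))
    (le_iInf fun l => ?_)
  rcases h l with rfl | rfl | rfl
  · exact inf_le_left.trans inf_le_left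
  · exact inf_le_left.trans inf_le_right
  · exact inf_le_right

theorem iInf_ne_eq_inf_of_fin_three {α : Type*} [CompleteLattice α] (f : Fin 3 → α) {i j k : Fin 3}
    (hij : i ≠ j) (hik : i ≠ k) (h : ∀ l, l = i ∨ l = j ∨ l = k) :
    ⨅ l ≠ i, f l = f j ⊓ f k := by
  refine le_antisymm (le_inf (iInf₂_le j hij.symm) (iInf₂_le k hik.symm)) (le_iInf₂ fun l hl => ?_)
  rcases h l with rfl | rfl | rfl
  · exact absurd rfl hl
  · exact inf_le_left
  · exact inf_le_right

theorem iSup_ne_eq_sup_of_fin_three {α : Type*} [CompleteLattice α] (f : Fin 3 → α) {i j k : Fin 3}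
    (hij : i ≠ j) (hik : i ≠ k) (h : ∀ l, l = i ∨ l = j ∨ l = k) :
    ⨆ l ≠ i, f l = f j ⊔ f k :=
  iInf_ne_eq_inf_of_fin_three (α := αᵒᵈ) f hij hik h

theorem exists_third {i j : Fin 3} (hij : i ≠ j) :
    ∃ k, i ≠ k ∧ j ≠ k ∧ ∀ l, l = i ∨ l = j ∨ l = k := by
  revert i j; decide

theorem biUnion_univ_eq_of_fin_three (A : Fin 3 → Finset (Fin n)) {i j k : Fin 3}
    (h : ∀ l, l = i ∨ l = j ∨ l = k) : Finset.univ.biUnion A = A i ∪ A j ∪ A k := by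
  ext x
  simp only [Finset.mem_biUnion, Finset.mem_univ, true_and, Finset.mem_union]
  constructor
  · rintro ⟨l, hl⟩
    rcases h l with rfl | rfl | rfl <;> tauto
  · rintro ((hx | hx) | hx)
    exacts [⟨i, hx⟩, ⟨j, hx⟩, ⟨k, hx⟩]

theorem decompositionSize_eq (hQ : ∀ i, IsMonomialPrimaryTo (A i) (Q i)) :
    decompositionSize Q = (radicalCoverNumber Q : ℤ) + (Finset.univ.biUnion A)ᶜ.card - 1 := by
  have h := (isMonomialPrimaryTo_biSup hQ Finset.univ_nonempty).height_eq
  simp only [Finset.mem_univ, iSup_pos] at h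
  have hc := Finset.card_add_card_compl (Finset.univ.biUnion A)
  rw [Fintype.card_fin] at hc
  rw [decompositionSize, h, ENat.toNat_natCast]
  omega

/-- If no `Qᵢ` is contained in the sum of the others, then the depth of `S/⋂ Qᵢ` is its size. -/
theorem depthQuot_eq_decompositionSize (hQ : ∀ i, IsMonomialPrimaryTo (A i) (Q i))
    (hirr : ∀ i, ¬ (⨅ j ≠ i, Q j) ≤ Q i) (hsup : ∀ i, ¬ Q i ≤ ⨆ j ≠ i, Q j) :
    ∃ D : ℕ, depthQuot (⨅ i, Q i) = D ∧ decompositionSize Q = D := by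
  have hI : ⨅ i, Q i ≤ idealOfVars (Fin n) K := (iInf_le _ 0).trans (hQ 0).le_idealOfVars
  have h012 : ∀ l : Fin 3, l = 0 ∨ l = 1 ∨ l = 2 := by decide
  set U := Finset.univ.biUnion A with hU
  have hU012 : U = A 0 ∪ A 1 ∪ A 2 := biUnion_univ_eq_of_fin_three A h012
  have hAU : ∀ i, A i ⊆ U := fun i => Finset.subset_biUnion_of_mem A (Finset.mem_univ i)
  have hd : ∀ i, Uᶜ.card ≤ (A i)ᶜ.card := fun i => card_compl_le_of_subset (hAU i)
  have hd2 : ∀ i j, Uᶜ.card ≤ (A i ∪ A j)ᶜ.card := fun i j =>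
    card_compl_le_of_subset (Finset.union_subset (hAU i) (hAU j))
  have hlower : ∀ r, (∀ i, r ≤ (A i)ᶜ.card) → (∀ i j, i ≠ j → r ≤ (A i ∪ A j)ᶜ.card + 1) →
      r ≤ Uᶜ.card + 2 → DepthQuotAtLeast (⨅ i, Q i) r := by
    intro r hr1 hr2 hr3
    rw [iInf_eq_inf_of_fin_three Q h012]
    exact depthQuotAtLeast_inf_inf (hQ 0) (hQ 1) (hQ 2) (hr1 0) (hr1 1) (hr1 2)
      (hr2 0 1 (by decide)) (hr2 0 2 (by decide)) (hr2 1 2 (by decide)) (hU012 ▸ hr3)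
  rw [decompositionSize_eq hQ, ← hU]
  -- one prime suffices: size and depth are `dim S/Pᵢ`
  by_cases hv1 : ∃ i, A i = U
  · obtain ⟨i, hi⟩ := hv1
    have hv : radicalCoverNumber Q = 1 := radicalCoverNumber_eq hQ (J := {i})
      (Finset.singleton_nonempty i) (Finset.card_singleton i) (by rw [Finset.singleton_biUnion, hi])
      fun J hJ _ => hJ.card_pos
    refine ⟨Uᶜ.card, depthQuot_eq hI
      (hlower _ hd (fun i j _ => (hd2 i j).trans (Nat.le_succ _)) (by omega)) fun h => ?_, ?_⟩
    · obtain ⟨j, hj⟩ := exists_ne i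
      obtain ⟨k, hik, -, hall⟩ := exists_third hj.symm
      rw [iInf_eq_inf_of_fin_three Q hall, inf_assoc] at h
      have := hirr i
      rw [iInf_ne_eq_inf_of_fin_three Q hj.symm hik hall] at this
      have := (hQ i).le_card_compl ((hQ j).isMonomialIdeal.inf (hQ k).isMonomialIdeal) this h
      rw [hi] at this
      omega
    · rw [hv]; omega
  have hd' : ∀ i, Uᶜ.card < (A i)ᶜ.card := fun i =>
    card_compl_lt_of_not_subset (hAU i) fun h => hv1 ⟨i, (hAU i).antisymm h⟩
  have hcard : ∀ J : Finset (Fin 3), J.Nonempty → J.biUnion A = U → 2 ≤ J.card := by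
    intro J hJ hJU
    by_contra! hlt
    obtain ⟨i, rfl⟩ := Finset.card_eq_one.1 (le_antisymm (Nat.le_of_lt_succ hlt) hJ.card_pos)
    exact hv1 ⟨i, by rwa [Finset.singleton_biUnion] at hJU⟩
  -- two primes suffice: size and depth are `1 + dim S/(P₁ + P₂ + P₃)`
  by_cases hv2 : ∃ i j, i ≠ j ∧ A i ∪ A j = U
  · obtain ⟨i, j, hij, hAij⟩ := hv2
    have hv : radicalCoverNumber Q = 2 := radicalCoverNumber_eq hQ (J := {i, j})
      ⟨i, Finset.mem_insert_self _ _⟩ (Finset.card_pair hij)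
      (by rw [Finset.biUnion_insert, Finset.singleton_biUnion, hAij]) hcard
    refine ⟨Uᶜ.card + 1, depthQuot_eq hI
      (hlower _ hd' (fun i j _ => by have := hd2 i j; omega) (by omega)) ?_, ?_⟩
    · obtain ⟨k, hik, hjk, hall⟩ := exists_third hij
      have hperm : ∀ l, l = k ∨ l = i ∨ l = j := fun l => by have := hall l; tauto
      have hnot := hsup k
      rw [iSup_ne_eq_sup_of_fin_three Q hik.symm hjk.symm hperm] at hnot
      rw [iInf_eq_inf_of_fin_three Q (i := i) (j := k) (k := j)
        fun l => by have := hall l; tauto, ← hAij]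
      refine not_depthQuotAtLeast_of_subset_union (hQ i) (hQ j) (hQ k) hnot (hAij ▸ hAU k) ?_ ?_ ?_
      · exact fun h => hv1 ⟨i, by rw [← hAij, Finset.union_eq_left.2 h]⟩
      · exact fun h => hv1 ⟨j, by rw [← hAij, Finset.union_eq_right.2 h]⟩
      · exact fun h => hv1 ⟨k, (hAU k).antisymm (hAij ▸ h)⟩
    · rw [hv]; push_cast; omega
  -- all three primes are needed: size and depth are `2 + dim S/(P₁ + P₂ + P₃)`
  · have hv : radicalCoverNumber Q = 3 := by
      refine radicalCoverNumber_eq hQ Finset.univ_nonempty (by simp) rfl fun J hJ hJU => ?_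
      by_contra! hlt
      obtain ⟨i, j, hij, rfl⟩ := Finset.card_eq_two.1
        (le_antisymm (Nat.le_of_lt_succ hlt) (hcard J hJ hJU))
      exact hv2 ⟨i, j, hij, by
        rwa [Finset.biUnion_insert, Finset.singleton_biUnion] at hJU⟩
    have hd2' : ∀ i j, i ≠ j → Uᶜ.card < (A i ∪ A j)ᶜ.card := fun i j hij =>
      card_compl_lt_of_not_subset (Finset.union_subset (hAU i) (hAU j)) fun h =>
        hv2 ⟨i, j, hij, (Finset.union_subset (hAU i) (hAU j)).antisymm h⟩
    have hns : ∀ i j k : Fin 3, i ≠ j → (∀ l, l = i ∨ l = j ∨ l = k) → ¬ A k ⊆ A i ∪ A j := by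
      intro i j k hij hall h
      exact hv2 ⟨i, j, hij, by
        rw [hU, biUnion_univ_eq_of_fin_three A hall, Finset.union_eq_left.2 h]⟩
    refine ⟨Uᶜ.card + 2, depthQuot_eq hI (hlower _ (fun i => ?_)
      (fun i j hij => by have := hd2' i j hij; omega) le_rfl) ?_, ?_⟩
    · obtain ⟨j, hj⟩ := exists_ne i
      obtain ⟨k, hik, hjk, hall⟩ := exists_third hj.symm
      have h1 := hd2' i j hj.symm
      have h2 : (A i ∪ A j)ᶜ.card < (A i)ᶜ.card :=
        card_compl_lt_of_not_subset Finset.subset_union_left fun h =>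
          hns i k j hik (fun l => by have := hall l; tauto)
            ((Finset.subset_union_right.trans h).trans Finset.subset_union_left)
      omega
    · rw [iInf_eq_inf_of_fin_three Q h012, hU012]
      exact not_depthQuotAtLeast_of_not_subset_union (hQ 0) (hQ 1) (hQ 2)
        (hns 1 2 0 (by decide) (by decide)) (hns 0 2 1 (by decide) (by decide))
        (hns 0 1 2 (by decide) (by decide))
    · rw [hv]; push_cast; omega

end Family

end ThreeComponents

theorem lemma1p1 {K : Type*} [Field K] {n : ℕ}
    (I : Ideal (MvPolynomial (Fin n) K))
    (Q P : Fin 3 → Ideal (MvPolynomial (Fin n) K))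
    (hQ : IsIrredundantMonomialPrimaryDecomposition I Q)
    (hP : ∀ i, P i = (Q i).radical)
    (hm : ∀ i, P i ≠ idealOfVars (Fin n) K) :
    -- (a)
    (P 0 ⊔ P 1 ⊔ P 2 = idealOfVars (Fin n) K →
      Q 0 ≤ Q 1 ⊔ Q 2 → ¬ P 0 ≤ P 1 → ¬ P 0 ≤ P 2 →
      (depthQuot I : WithBot ℕ∞) =
        1 + min (ringKrullDim (MvPolynomial (Fin n) K ⧸ (P 0 ⊔ P 1)))
          (ringKrullDim (MvPolynomial (Fin n) K ⧸ (P 0 ⊔ P 2)))) ∧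
    -- (b)
    (Q 0 ≤ Q 1 ⊔ Q 2 → P 0 ≤ P 1 → ¬ P 0 ≤ P 2 →
      (depthQuot I : WithBot ℕ∞) =
        min (ringKrullDim (MvPolynomial (Fin n) K ⧸ P 1))
          (1 + ringKrullDim (MvPolynomial (Fin n) K ⧸ (P 0 ⊔ P 2)))) ∧
    -- (c)
    (Q 0 ≤ Q 1 ⊔ Q 2 → P 0 ≤ P 1 → P 0 ≤ P 2 →
      (depthQuot I : WithBot ℕ∞) =
        min (ringKrullDim (MvPolynomial (Fin n) K ⧸ P 1))
          (ringKrullDim (MvPolynomial (Fin n) K ⧸ P 2))) ∧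
    -- (d)
    ((∀ i, ¬ Q i ≤ ⨆ j ≠ i, Q j) → (depthQuot I = 1 ↔ decompositionSize Q = 1)) ∧
    -- (e)
    ((∀ i, ¬ Q i ≤ ⨆ j ≠ i, Q j) → (depthQuot I = 2 ↔ decompositionSize Q = 2)) := by
  choose A hA using fun i => exists_isMonomialPrimaryTo (hQ.monomial i) (hQ.primary i)
  obtain rfl : P = fun i => varIdeal K (A i) := funext fun i => (hP i).trans (hA i).radical_eq
  obtain rfl := hQ.eq_iInf
  have hirr := hQ.irredundant
  have h0 : ¬ Q 1 ⊓ Q 2 ≤ Q 0 := by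
    rw [← iInf_ne_eq_inf_of_fin_three Q (i := 0) (by decide) (by decide) (by decide)]
    exact hirr 0
  have h1 : ¬ Q 0 ⊓ Q 2 ≤ Q 1 := by
    rw [← iInf_ne_eq_inf_of_fin_three Q (i := 1) (by decide) (by decide) (by decide)]
    exact hirr 1
  have h2 : ¬ Q 0 ⊓ Q 1 ≤ Q 2 := by
    rw [← iInf_ne_eq_inf_of_fin_three Q (i := 2) (by decide) (by decide) (by decide)]
    exact hirr 2
  have hI : ⨅ i, Q i = Q 0 ⊓ Q 1 ⊓ Q 2 := iInf_eq_inf_of_fin_three Q (by decide)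
  have hdim : ∀ i j, ringKrullDim (MvPolynomial (Fin n) K ⧸ varIdeal K (A i) ⊔ varIdeal K (A j)) =
      ((A i ∪ A j)ᶜ.card : ℕ) := fun i j => by rw [← varIdeal_union, ringKrullDim_varIdeal]
  simp only [hdim, ringKrullDim_varIdeal, varIdeal_le_varIdeal_iff]
  refine ⟨fun hm' hle h01 h02 => ?_, fun hle h01 h02 => ?_, fun hle h01 h02 => ?_,
    fun hsup => ?_, fun hsup => ?_⟩
  · have hne : ¬ A 1 ∪ A 2 ⊆ A 0 := by
      intro h
      refine hm 0 ?_
      rw [← hm', ← varIdeal_union, ← varIdeal_union, Finset.union_assoc, Finset.union_eq_left.2 h]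
    rw [hI, depthQuot_eq_one_add_min (hA 0) (hA 1) (hA 2) hle h0 h01 h02 hne]
    norm_cast
  · rw [hI, depthQuot_eq_min_one_add (hA 0) (hA 1) (hA 2) hle h0 h1 h01 h02]
    norm_cast
  · rw [hI, depthQuot_eq_min (hA 0) (hA 1) (hA 2) hle h0 h1 h2 h01 h02]
    norm_cast
  · obtain ⟨D, hD, hD'⟩ := depthQuot_eq_decompositionSize hA hirr hsup
    rw [hD, hD']
    norm_cast
  · obtain ⟨D, hD, hD'⟩ := depthQuot_eq_decompositionSize hA hirr hsup
    rw [hD, hD']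
    norm_cast
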